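/- For $N\ge 1$ and an $N\times N$ complex Hadamard matrix $H$ (that is, $H\in M_N(\mathbb T)\cap\sqrt N\,U_N$, where $M_N(\mathbb T)$ is the set of $N\times N$ matrices with all entries of modulus $1$ and $U_N$ is the unitary group), the undephased defect of $H$ is the real dimension $$d(H)=\dim_{\mathbb R}\left(T_HM_N(\mathbb T)\cap T_H\sqrt N\,U_N\right)$$ of the intersection of the tangent spaces at $H$ of the two smooth real submanifolds $M_N(\mathbb T)$ and $\sqrt N\,U_N$ of $M_N(\mathbb C)$. The Fourier matrix of a finite abelian group $G=\mathbb Z_{N_1}\times\cdots\times\mathbb Z_{N_s}$ is $F_G=F_{N_1}\otimes\cdots\otimes F_{N_s}$, where $F_n=(e^{2\pi \mathrm{i}\,jk/n})_{0\le j,k<n}$. **Theorem.** Let $G$ be a finite abelian group, and let $F_G$ be its Fourier matrix with respect to any decomposition of $G$ as a product of cyclic groups. Decompose $G=\prod_{p}G_p$ over a finite set of primes $p$, with $$G_p\cong\mathbb Z_{p^{a_1}}\times\cdots\times\mathbb Z_{p^{a_r}},\qquad a_1\le a_2\le\cdots\le a_r,\qquad a_0=0,$$ where $r$ and the $a_k$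 depend on $p$. Then $$d(F_G)=|G|\prod_p\left(1+\sum_{k=1}^r p^{(r-k)a_{k-1}+(a_1+\cdots+a_{k-1})-1}\,\bigl(p^{r-k+1}-1\bigr)\,[a_k-a_{k-1}]_{p^{r-k}}\right),$$ where $[a]_q=1+q+q^2+\cdots+q^{a-1}$ (so $[0]_q=0$). -/

import Mathlib

open scoped ContDiff

noncomputable section

namespace FourierDefect

variable {ι : Type*} [Fintype ι] [DecidableEq ι]

/-- Matrices all of whose entries lie on the unit circle. -/
def torusMatrices (ι : Type*) : Set (Matrix ι ι ℂ) :=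
  {H | ∀ i j, ‖H i j‖ = 1}

/-- The rescaled unitary group `√N U_N`, where `N` is the number of indices. -/
def scaledUnitary (ι : Type*) [Fintype ι] [DecidableEq ι] : Set (Matrix ι ι ℂ) :=
  {H | ∃ U ∈ Matrix.unitaryGroup ι ℂ, H = ((Real.sqrt (Fintype.card ι) : ℝ) : ℂ) • U}

/-- The tangent space at `H` to a smooth real submanifold `M` of the complex matrices: the real
vector space of the velocities at time `0` of the smooth curves in `M` that pass through `H` at
time `0`. For a submanifold these velocities already form a real vector space, so the span adds
nothing. -/
def tangentSpaceAt (M : Set (Matrix ι ι ℂ)) (H : Matrix ι ι ℂ) : Submodule ℝ (Matrix ι ι ℂ) :=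
  Submodule.span ℝ
    {V | ∃ γ : ℝ → Matrix ι ι ℂ, (∀ i j, ContDiff ℝ ∞ (fun t => γ t i j)) ∧
      (∀ t, γ t ∈ M) ∧ γ 0 = H ∧ ∀ i j, HasDerivAt (fun t => γ t i j) (V i j) 0}

/-- The enveloping tangent space at `H` of the set of complex Hadamard matrices. -/
def envelopingTangentSpace (H : Matrix ι ι ℂ) : Submodule ℝ (Matrix ι ι ℂ) :=
  tangentSpaceAt (torusMatrices ι) H ⊓ tangentSpaceAt (scaledUnitary ι) H

/-- The undephased defect: the real dimension of the enveloping tangent space. -/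
def undephasedDefect (H : Matrix ι ι ℂ) : ℕ :=
  Module.finrank ℝ (envelopingTangentSpace H)

/-- The Fourier matrix `F_N = (w ^ (i j))`, with `w = exp (2 π i / N)` and `0 ≤ i, j < N`. -/
def cyclicFourierMatrix (N : ℕ) : Matrix (ZMod N) (ZMod N) ℂ :=
  Matrix.of fun i j => Complex.exp (2 * Real.pi * Complex.I / N) ^ (i.val * j.val)

/-- The Fourier matrix `F_{N_1} ⊗ ⋯ ⊗ F_{N_s}` of a group `G` identified by `e` with
`ℤ_{N_1} × ⋯ × ℤ_{N_s}`; its rows and columns are indexed by `G`. -/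
def fourierMatrix {G : Type*} [AddCommGroup G] {s : ℕ} {N : Fin s → ℕ}
    (e : G ≃+ ((i : Fin s) → ZMod (N i))) : Matrix G G ℂ :=
  Matrix.of fun g h => ∏ i, cyclicFourierMatrix (N i) (e g i) (e h i)

/-- `[n]_q = 1 + q + ⋯ + q ^ (n - 1)`. -/
def qNumber (n : ℕ) (q : ℚ) : ℚ := ∑ i ∈ Finset.range n, q ^ i

/-- The factor contributed by a prime `p` to the defect, for the exponents
`0 = a 0 ≤ a 1 ≤ ⋯ ≤ a r`. -/
def primeFactorTerm (p r : ℕ) (a : ℕ → ℕ) : ℚ :=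
  1 + ∑ k ∈ Finset.Icc 1 r,
    (p : ℚ) ^ ((((r - k) * a (k - 1) + ∑ l ∈ Finset.Icc 1 (k - 1), a l : ℕ) : ℤ) - 1) *
      ((p : ℚ) ^ (r - k + 1) - 1) * qNumber (a k - a (k - 1)) ((p : ℚ) ^ (r - k))

end FourierDefect

end

open scoped ContDiff

noncomputable section

namespace FourierDefect

/-! ### Tangent spaces of the torus matrices and of the rescaled unitary group -/

section TangentSpaces

open Matrix ComplexConjugate

/-! Tangent vectors to the torus matrices at `H` are `V i j = I * A i j * H i j` with `A` real, and
those to `√N U_N` satisfy `V * Hᴴ + H * Vᴴ = 0`. Together they give the linear system `∑ k, H i k *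
conj (H j k) * (A i k - A j k) = 0`, whose complex solution space is stable under conjugation; hence
the defect is its complex dimension (`undephasedDefect_eq_finrank`).

For a Fourier matrix `F`, `F i k * conj (F j k) = F (i - j) k`. With `P = A * Fᵀ` the system becomes
`P i (i - j) = P j (i - j)`: column `m` of `P` is constant on the cosets of `⟨m⟩`. So the defect is
the sum of `|G| / ord m` over `m` (`undephasedDefect_eq_sum`).

The sum of `1 / ord` is multiplicative over coprime factors. In a `p`-group it is found by counting
`p ^ j`-torsion, of order `p ^ ∑ min (a_l, j)`. That exponent is linear in `j` between consecutive
`a_k`, so each block is a geometric series, whence the `q`-numbers. -/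

theorem mem_tangentSpaceAt_torusMatrices {ι : Type*} {H : Matrix ι ι ℂ} (hH : H ∈ torusMatrices ι)
    {V : Matrix ι ι ℂ} :
    V ∈ tangentSpaceAt (torusMatrices ι) H ↔
      ∃ A : Matrix ι ι ℝ, ∀ i j, V i j = Complex.I * A i j * H i j := by
  constructor
  · intro hV
    induction hV using Submodule.span_induction with
    | mem V hV =>
      obtain ⟨γ, -, hγM, hγ0, hγ'⟩ := hV
      -- Differentiating `|γ i j|² = 1` shows that `V i j * conj (H i j)` is purely imaginary.
      refine ⟨fun i j => (V i j * conj (H i j)).im, fun i j => ?_⟩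
      have h1 := (hγ' i j).mul (hγ' i j).star
      have h2 : (fun t => γ t i j) * (fun t => star (γ t i j)) = fun _ => (1 : ℂ) := by
        funext t
        simp only [Pi.mul_apply, RCLike.star_def]
        rw [Complex.mul_conj, Complex.normSq_eq_norm_sq, hγM t i j]
        simp
      have h3 := h1.unique (by rw [h2]; exact hasDerivAt_const _ _)
      simp only [hγ0] at h3
      have hn : H i j * conj (H i j) = 1 := by
        rw [Complex.mul_conj, Complex.normSq_eq_norm_sq, hH i j]; simp
      have hre : (V i j * conj (H i j)).re = 0 := by
        have := congrArg Complex.re h3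
        simp at this ⊢
        linarith
      have hI : V i j * conj (H i j) = Complex.I * ((V i j * conj (H i j)).im : ℂ) := by
        apply Complex.ext
        · simpa using hre
        · simp
      rw [← hI, mul_assoc, mul_comm (conj _), hn, mul_one]
    | zero => exact ⟨0, by simp⟩
    | add V W _ _ hV hW =>
      obtain ⟨A, hA⟩ := hV
      obtain ⟨B, hB⟩ := hW
      refine ⟨A + B, fun i j => ?_⟩
      simp only [Matrix.add_apply, hA, hB, Complex.ofReal_add]
      ring
    | smul c V _ hV =>
      obtain ⟨A, hA⟩ := hV
      refine ⟨c • A, fun i j => ?_⟩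
      simp only [Matrix.smul_apply, hA, Complex.real_smul, smul_eq_mul, Complex.ofReal_mul]
      ring
  · rintro ⟨A, hA⟩
    refine Submodule.subset_span
      ⟨fun t => Matrix.of fun i j => Complex.exp (t * (A i j * Complex.I)) * H i j, fun i j => ?_, fun t i j => ?_,
        ?_, fun i j => ?_⟩
    · have : ContDiff ℝ ∞ (fun t : ℝ => (t : ℂ)) := Complex.ofRealCLM.contDiff
      exact ((this.mul contDiff_const).cexp).mul contDiff_const
    · change ‖Complex.exp (t * (A i j * Complex.I)) * H i j‖ = 1
      rw [norm_mul, hH i j, ← mul_assoc, ← Complex.ofReal_mul, Complex.norm_exp_ofReal_mul_I, one_mul]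
    · ext i j
      simp
    · have h := (((hasDerivAt_id (0 : ℝ)).ofReal_comp.mul_const (A i j * Complex.I)).cexp).mul_const
        (H i j)
      refine h.congr_deriv ?_
      rw [hA]
      simp [mul_comm]

theorem hasDerivAt_mul_conjTranspose_apply {ι : Type*} [Fintype ι] {γ : ℝ → Matrix ι ι ℂ} {V : Matrix ι ι ℂ}
    {t : ℝ} (h : ∀ i j, HasDerivAt (fun t => γ t i j) (V i j) t) (i j : ι) :
    HasDerivAt (fun t => (γ t * (γ t)ᴴ) i j) ((V * (γ t)ᴴ + γ t * Vᴴ) i j) t := by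
  simp only [Matrix.add_apply, Matrix.mul_apply, Matrix.conjTranspose_apply,
    ← Finset.sum_add_distrib]
  exact HasDerivAt.fun_sum fun k _ => (h i k).mul (h j k).star

variable {ι : Type*} [Fintype ι] [DecidableEq ι]

theorem mul_conjTranspose_of_mem_scaledUnitary {H : Matrix ι ι ℂ} (hH : H ∈ scaledUnitary ι) :
    H * Hᴴ = (Fintype.card ι : ℂ) • 1 := by
  obtain ⟨U, hU, rfl⟩ := hH
  rw [Matrix.conjTranspose_smul, Matrix.smul_mul, Matrix.mul_smul, smul_smul,
    ← Matrix.star_eq_conjTranspose, Matrix.mem_unitaryGroup_iff.1 hU]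
  congr 1
  simp only [RCLike.star_def, Complex.conj_ofReal]
  rw [← Complex.ofReal_mul, Real.mul_self_sqrt (Nat.cast_nonneg _)]
  simp

theorem conjTranspose_mul_of_mem_scaledUnitary {H : Matrix ι ι ℂ} (hH : H ∈ scaledUnitary ι) :
    Hᴴ * H = (Fintype.card ι : ℂ) • 1 := by
  obtain ⟨U, hU, rfl⟩ := hH
  rw [Matrix.conjTranspose_smul, Matrix.smul_mul, Matrix.mul_smul, smul_smul,
    ← Matrix.star_eq_conjTranspose, Matrix.mem_unitaryGroup_iff'.1 hU]
  congr 1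
  simp only [RCLike.star_def, Complex.conj_ofReal]
  rw [← Complex.ofReal_mul, Real.mul_self_sqrt (Nat.cast_nonneg _)]
  simp

section Exponential

attribute [local instance] Matrix.linftyOpNormedAddCommGroup Matrix.linftyOpNormedSpace
  Matrix.linftyOpNormedRing Matrix.linftyOpNormedAlgebra

/-- Multiplication by a fixed matrix followed by the reading of an entry. -/
def mulRightEntry (H : Matrix ι ι ℂ) (i j : ι) : Matrix ι ι ℂ →L[ℝ] ℂ :=
  LinearMap.toContinuousLinearMap
    { toFun := fun X => (X * H) i j
      map_add' := fun X Y => by rw [Matrix.add_mul, Matrix.add_apply]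
      map_smul' := fun c X => by rw [Matrix.smul_mul, Matrix.smul_apply, RingHom.id_apply] }

/-- Smoothness holds for the auxiliary norm and is read through a continuous functional, so the
entrywise statement does not involve that norm. -/
theorem contDiff_exp_smul_mul_apply (B H : Matrix ι ι ℂ) (i j : ι) :
    ContDiff ℝ ∞ (fun t : ℝ => (NormedSpace.exp (t • B) * H) i j) := by
  have h1 : ContDiff ℝ ∞ (NormedSpace.exp : Matrix ι ι ℂ → Matrix ι ι ℂ) :=
    contDiff_iff_contDiffAt.2 fun x => (NormedSpace.exp_analytic (𝕂 := ℝ) x).contDiffAt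
  exact (mulRightEntry H i j).contDiff.comp (h1.comp (contDiff_id.smul contDiff_const))

theorem hasDerivAt_exp_smul_mul_apply (B H : Matrix ι ι ℂ) (i j : ι) :
    HasDerivAt (fun t : ℝ => (NormedSpace.exp (t • B) * H) i j) ((B * H) i j) 0 := by
  have h := hasDerivAt_exp_smul_const (𝕂 := ℝ) B (0 : ℝ)
  rw [zero_smul, NormedSpace.exp_zero, one_mul] at h
  exact (mulRightEntry H i j).hasFDerivAt.comp_hasDerivAt (0 : ℝ) h

theorem exp_smul_mem_unitaryGroup {B : Matrix ι ι ℂ} (hB : Bᴴ = -B) (t : ℝ) :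
    NormedSpace.exp (t • B) ∈ Matrix.unitaryGroup ι ℂ := by
  rw [Matrix.mem_unitaryGroup_iff, Matrix.star_eq_conjTranspose, ← Matrix.exp_conjTranspose,
    Matrix.conjTranspose_smul, hB, star_trivial, smul_neg, Matrix.exp_neg]
  exact Matrix.mul_nonsing_inv _ ((Matrix.isUnit_iff_isUnit_det _).1 (Matrix.isUnit_exp _))

end Exponential

theorem mem_tangentSpaceAt_scaledUnitary [Nonempty ι] {H : Matrix ι ι ℂ}
    (hH : H ∈ scaledUnitary ι) {V : Matrix ι ι ℂ} :
    V ∈ tangentSpaceAt (scaledUnitary ι) H ↔ V * Hᴴ + H * Vᴴ = 0 := by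
  constructor
  · intro hV
    induction hV using Submodule.span_induction with
    | mem V hV =>
      obtain ⟨γ, -, hγM, hγ0, hγ'⟩ := hV
      ext i j
      have h1 := hasDerivAt_mul_conjTranspose_apply hγ' i j
      simp only [mul_conjTranspose_of_mem_scaledUnitary (hγM _), hγ0] at h1
      exact h1.unique (hasDerivAt_const _ _)
    | zero => simp
    | add V W _ _ hV hW =>
      rw [Matrix.conjTranspose_add, Matrix.add_mul, Matrix.mul_add, add_add_add_comm, hV, hW,
        add_zero]
    | smul c V _ hV =>
      rw [Matrix.conjTranspose_smul, star_trivial, Matrix.smul_mul, Matrix.mul_smul, ← smul_add,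
        hV, smul_zero]
  · intro hV
    have hN : (Fintype.card ι : ℂ) ≠ 0 := Nat.cast_ne_zero.2 Fintype.card_ne_zero
    -- Since `Hᴴ * H = N`, this `B` solves `B * H = V`; the tangent equation makes it
    -- skew-Hermitian, so `exp (t B) * H` is the required curve.
    let B : Matrix ι ι ℂ := (Fintype.card ι : ℂ)⁻¹ • (V * Hᴴ)
    have hBH : B * H = V := by
      rw [Matrix.smul_mul, Matrix.mul_assoc, conjTranspose_mul_of_mem_scaledUnitary hH,
        Matrix.mul_smul, Matrix.mul_one, smul_smul, inv_mul_cancel₀ hN, one_smul]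
    have hB : Bᴴ = -B := by
      rw [Matrix.conjTranspose_smul, Matrix.conjTranspose_mul, Matrix.conjTranspose_conjTranspose,
        ← smul_neg, eq_neg_of_add_eq_zero_right hV]
      simp
    refine Submodule.subset_span ⟨fun t => NormedSpace.exp (t • B) * H,
      contDiff_exp_smul_mul_apply B H, fun t => ?_, by simp, fun i j => ?_⟩
    · obtain ⟨U, hU, rfl⟩ := hH
      exact ⟨_, mul_mem (exp_smul_mem_unitaryGroup hB t) hU, Matrix.mul_smul _ _ _⟩
    · rw [← hBH]
      exact hasDerivAt_exp_smul_mul_apply B H i j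

end TangentSpaces

/-! ### The defect as the dimension of a complex linear system -/

section Deformations

open Matrix ComplexConjugate

variable {ι : Type*} [Fintype ι]

/-- The complex matrices `A` with `∑ k, H i k * conj (H j k) * (A i k - A j k) = 0`
for all `i` and `j`. -/
def complexDeformations (H : Matrix ι ι ℂ) : Submodule ℂ (Matrix ι ι ℂ) where
  carrier := {A | ∀ i j, ∑ k, H i k * conj (H j k) * (A i k - A j k) = 0}
  zero_mem' := by simp
  add_mem' := by
    intro A B hA hB i j
    rw [← add_zero (0 : ℂ)]
    nth_rewrite 1 [← hA i j]
    rw [← hB i j, ← Finset.sum_add_distrib]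
    refine Finset.sum_congr rfl fun k _ => ?_
    simp only [Matrix.add_apply]
    ring
  smul_mem' := by
    intro c A hA i j
    rw [← mul_zero c, ← hA i j, Finset.mul_sum]
    refine Finset.sum_congr rfl fun k _ => ?_
    simp only [Matrix.smul_apply, smul_eq_mul]
    ring

theorem mem_complexDeformations {H A : Matrix ι ι ℂ} :
    A ∈ complexDeformations H ↔ ∀ i j, ∑ k, H i k * conj (H j k) * (A i k - A j k) = 0 :=
  Iff.rfl

/-- The inclusion of the real matrices into the complex ones. -/
def ofRealMatrix (ι : Type*) : Matrix ι ι ℝ →ₗ[ℝ] Matrix ι ι ℂ :=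
  Complex.ofRealCLM.toLinearMap.mapMatrix

theorem ofRealMatrix_apply {ι : Type*} (A : Matrix ι ι ℝ) (i j : ι) : ofRealMatrix ι A i j = A i j :=
  rfl

/-- The real matrices in `complexDeformations H`. -/
def realDeformations (H : Matrix ι ι ℂ) : Submodule ℝ (Matrix ι ι ℝ) :=
  ((complexDeformations H).restrictScalars ℝ).comap (ofRealMatrix ι)

/-- Conjugating the equation for `(j, i)` gives minus the equation for `(i, j)`. -/
theorem map_conj_mem_complexDeformations {H A : Matrix ι ι ℂ} (hA : A ∈ complexDeformations H) :
    A.map conj ∈ complexDeformations H := by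
  intro i j
  have h := congrArg conj (hA j i)
  rw [map_sum, map_zero] at h
  rw [← neg_zero, ← h, ← Finset.sum_neg_distrib]
  refine Finset.sum_congr rfl fun k _ => ?_
  simp only [map_mul, map_sub, Matrix.map_apply, Complex.conj_conj]
  ring

theorem map_re_mem_realDeformations {H A : Matrix ι ι ℂ} (hA : A ∈ complexDeformations H) :
    A.map Complex.re ∈ realDeformations H := by
  have h : ofRealMatrix ι (A.map Complex.re) = (2⁻¹ : ℂ) • (A + A.map conj) := by
    ext i j
    simp only [ofRealMatrix_apply, Matrix.map_apply, Matrix.smul_apply, Matrix.add_apply,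
      Complex.add_conj, smul_eq_mul]
    push_cast
    ring
  change ofRealMatrix ι (A.map Complex.re) ∈ complexDeformations H
  rw [h]
  exact Submodule.smul_mem _ _ (Submodule.add_mem _ hA (map_conj_mem_complexDeformations hA))

theorem map_im_mem_realDeformations {H A : Matrix ι ι ℂ} (hA : A ∈ complexDeformations H) :
    A.map Complex.im ∈ realDeformations H := by
  have h := map_re_mem_realDeformations (Submodule.smul_mem _ (-Complex.I) hA)
  convert h using 1
  ext i j
  simp

/-- Real and imaginary parts identify `complexDeformations H` with two copies of
`realDeformations H`. -/
def complexDeformationsEquiv (H : Matrix ι ι ℂ) :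
    complexDeformations H ≃ₗ[ℝ] realDeformations H × realDeformations H where
  toFun A := (⟨_, map_re_mem_realDeformations A.2⟩, ⟨_, map_im_mem_realDeformations A.2⟩)
  invFun B := ⟨ofRealMatrix ι B.1 + Complex.I • ofRealMatrix ι B.2,
    Submodule.add_mem _ B.1.2 (Submodule.smul_mem _ _ B.2.2)⟩
  map_add' A B := by
    ext i j <;> simp
  map_smul' c A := by
    ext i j <;> simp
  left_inv A := by
    ext i j
    simp only [Matrix.add_apply, Matrix.smul_apply, ofRealMatrix_apply, Matrix.map_apply,
      smul_eq_mul, mul_comm Complex.I, Complex.re_add_im]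
  right_inv B := by
    ext i j <;> simp [ofRealMatrix_apply]

theorem finrank_realDeformations (H : Matrix ι ι ℂ) :
    Module.finrank ℝ (realDeformations H) = Module.finrank ℂ (complexDeformations H) := by
  have h1 := (complexDeformationsEquiv H).finrank_eq
  rw [Module.finrank_prod, finrank_real_of_complex] at h1
  omega

/-- The map `A ↦ (i A_{jk} H_{jk})`, which parametrises the tangent space of the torus
matrices at `H`. -/
def torusTangent {ι : Type*} (H : Matrix ι ι ℂ) : Matrix ι ι ℝ →ₗ[ℝ] Matrix ι ι ℂ where
  toFun A := Matrix.of fun i j => Complex.I * A i j * H i j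
  map_add' A B := by
    ext i j
    simp only [Matrix.of_apply, Matrix.add_apply, Complex.ofReal_add]
    ring
  map_smul' c A := by
    ext i j
    simp only [Matrix.of_apply, Matrix.smul_apply, Complex.real_smul, smul_eq_mul,
      Complex.ofReal_mul, RingHom.id_apply]
    ring

theorem torusTangent_apply {ι : Type*} (H : Matrix ι ι ℂ) (A : Matrix ι ι ℝ) (i j : ι) :
    torusTangent H A i j = Complex.I * A i j * H i j :=
  rfl

theorem torusTangent_injective {ι : Type*} {H : Matrix ι ι ℂ} (hH : H ∈ torusMatrices ι) :
    Function.Injective (torusTangent H) := by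
  intro A B h
  ext i j
  have hij := congrFun (congrFun h i) j
  have hne : H i j ≠ 0 := norm_ne_zero_iff.1 (by rw [hH i j]; exact one_ne_zero)
  simpa [torusTangent_apply, hne] using hij

theorem torusTangent_mul_conjTranspose_add (H : Matrix ι ι ℂ) (A : Matrix ι ι ℝ) (i j : ι) :
    (torusTangent H A * Hᴴ + H * (torusTangent H A)ᴴ) i j =
      Complex.I * ∑ k, H i k * conj (H j k) * (ofRealMatrix ι A i k - ofRealMatrix ι A j k) := by
  simp only [Matrix.add_apply, Matrix.mul_apply, ← Finset.sum_add_distrib, Finset.mul_sum,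
    Matrix.conjTranspose_apply, torusTangent_apply, ofRealMatrix_apply]
  refine Finset.sum_congr rfl fun k _ => ?_
  simp only [RCLike.star_def, map_mul, Complex.conj_I, Complex.conj_ofReal]
  ring

variable [DecidableEq ι]

theorem envelopingTangentSpace_eq_map [Nonempty ι] {H : Matrix ι ι ℂ} (hT : H ∈ torusMatrices ι)
    (hU : H ∈ scaledUnitary ι) :
    envelopingTangentSpace H = (realDeformations H).map (torusTangent H) := by
  have key (A : Matrix ι ι ℝ) : torusTangent H A * Hᴴ + H * (torusTangent H A)ᴴ = 0 ↔
      A ∈ realDeformations H := by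
    rw [← Matrix.ext_iff]
    simp only [torusTangent_mul_conjTranspose_add, Matrix.zero_apply, mul_eq_zero, Complex.I_ne_zero,
      false_or]
    rfl
  ext V
  rw [envelopingTangentSpace, Submodule.mem_inf, mem_tangentSpaceAt_torusMatrices hT,
    mem_tangentSpaceAt_scaledUnitary hU, Submodule.mem_map]
  constructor
  · rintro ⟨⟨A, hA⟩, hV⟩
    obtain rfl : torusTangent H A = V := by
      ext i j
      rw [hA, torusTangent_apply]
    exact ⟨A, (key A).1 hV, rfl⟩
  · rintro ⟨A, hA, rfl⟩
    exact ⟨⟨A, fun i j => rfl⟩, (key A).2 hA⟩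

theorem undephasedDefect_eq_finrank [Nonempty ι] {H : Matrix ι ι ℂ} (hT : H ∈ torusMatrices ι)
    (hU : H ∈ scaledUnitary ι) :
    undephasedDefect H = Module.finrank ℂ (complexDeformations H) := by
  rw [undephasedDefect, envelopingTangentSpace_eq_map hT hU, ← finrank_realDeformations]
  exact (Submodule.equivMapOfInjective _ (torusTangent_injective hT) _).finrank_eq.symm

end Deformations

/-! ### Matrices with multiplicative rows: the defect as a sum over orders -/

section CharacterMatrices

open Matrix ComplexConjugate

variable {G : Type*} [AddCommGroup G]

/-- Matrices whose column `m` is invariant under translation by `m`. -/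
def periodicMatrices (G : Type*) [AddCommGroup G] : Submodule ℂ (Matrix G G ℂ) where
  carrier := {P | ∀ i m, P i m = P (i - m) m}
  zero_mem' := by simp
  add_mem' := by
    intro P Q hP hQ i m
    rw [Matrix.add_apply, hP, hQ, Matrix.add_apply]
  smul_mem' := by
    intro c P hP i m
    rw [Matrix.smul_apply, hP, Matrix.smul_apply]

/-- A matrix in `periodicMatrices G` is a family of functions on the quotients by the cyclic
subgroups generated by the column indices. -/
def periodicOfQuotient (G : Type*) [AddCommGroup G] :
    ((m : G) → G ⧸ AddSubgroup.zmultiples m → ℂ) →ₗ[ℂ] Matrix G G ℂ where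
  toFun f := Matrix.of fun i m => f m i
  map_add' _ _ := rfl
  map_smul' _ _ := rfl

theorem periodicOfQuotient_injective : Function.Injective (periodicOfQuotient G) := by
  intro f g h
  funext m x
  induction x using QuotientAddGroup.induction_on with
  | H i => exact congrFun (congrFun h i) m

theorem apply_add_zsmul_of_mem_periodicMatrices {P : Matrix G G ℂ} (hP : P ∈ periodicMatrices G)
    (i m : G) (n : ℤ) : P (i + n • m) m = P i m := by
  induction n using Int.induction_on with
  | zero => simp
  | succ n ih =>
    rw [hP, ← ih, add_zsmul, one_zsmul]
    congr 1
    abel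
  | pred n ih =>
    rw [← ih, hP (i + (-(n : ℤ)) • m), sub_zsmul, one_zsmul]
    congr 1
    abel

theorem range_periodicOfQuotient :
    LinearMap.range (periodicOfQuotient G) = periodicMatrices G := by
  ext P
  constructor
  · rintro ⟨f, rfl⟩ i m
    refine congrArg (f m) (QuotientAddGroup.eq.2 ?_)
    exact ⟨-1, by simp; abel⟩
  · intro hP
    refine ⟨fun m => Quotient.lift (fun i => P i m) ?_, rfl⟩
    intro i j hij
    obtain ⟨n, hn⟩ := QuotientAddGroup.leftRel_apply.1 hij
    have : j = i + n • m := by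
      change n • m = -i + j at hn
      rw [hn]
      abel
    rw [this, apply_add_zsmul_of_mem_periodicMatrices hP]

variable [Fintype G]

/-- Column `m` is an arbitrary function on `G ⧸ ⟨m⟩`, which has `|G| / ord m` elements. -/
theorem finrank_periodicMatrices :
    Module.finrank ℂ (periodicMatrices G) = ∑ m : G, Fintype.card G / addOrderOf m := by
  classical
  rw [← range_periodicOfQuotient,
    LinearMap.finrank_range_of_inj periodicOfQuotient_injective, Module.finrank_pi_fintype]
  refine Finset.sum_congr rfl fun m _ => ?_
  rw [Module.finrank_fintype_fun_eq_card, ← Nat.card_eq_fintype_card, ← Nat.card_eq_fintype_card,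
    (AddSubgroup.zmultiples m).card_eq_card_quotient_mul_card_addSubgroup, Nat.card_zmultiples,
    Nat.mul_div_cancel _ (addOrderOf_pos m)]

variable [DecidableEq G]

/-- Multiplication on the right by the transpose of a matrix in `√N U_N`. -/
def mulTransposeEquiv {F : Matrix G G ℂ} (hF : F ∈ scaledUnitary G) :
    Matrix G G ℂ ≃ₗ[ℂ] Matrix G G ℂ where
  toFun A := A * Fᵀ
  invFun P := (Fintype.card G : ℂ)⁻¹ • (P * Fᴴᵀ)
  map_add' A B := Matrix.add_mul _ _ _
  map_smul' c A := Matrix.smul_mul _ _ _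
  left_inv A := by
    have hN : (Fintype.card G : ℂ) ≠ 0 := Nat.cast_ne_zero.2 Fintype.card_ne_zero
    beta_reduce
    rw [Matrix.mul_assoc, ← Matrix.transpose_mul, conjTranspose_mul_of_mem_scaledUnitary hF,
      Matrix.transpose_smul, Matrix.transpose_one, Matrix.mul_smul, Matrix.mul_one, smul_smul,
      inv_mul_cancel₀ hN, one_smul]
  right_inv P := by
    have hN : (Fintype.card G : ℂ) ≠ 0 := Nat.cast_ne_zero.2 Fintype.card_ne_zero
    beta_reduce
    rw [Matrix.smul_mul, Matrix.mul_assoc, ← Matrix.transpose_mul,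
      mul_conjTranspose_of_mem_scaledUnitary hF,
      Matrix.transpose_smul, Matrix.transpose_one, Matrix.mul_smul, Matrix.mul_one, smul_smul,
      inv_mul_cancel₀ hN, one_smul]

theorem mulTransposeEquiv_apply {F : Matrix G G ℂ} (hF : F ∈ scaledUnitary G)
    (A : Matrix G G ℂ) : mulTransposeEquiv hF A = A * Fᵀ :=
  rfl

theorem complexDeformations_eq_comap {F : Matrix G G ℂ} (hF : F ∈ scaledUnitary G)
    (hmul : ∀ i j k, F i k * conj (F j k) = F (i - j) k) :
    complexDeformations F =
      (periodicMatrices G).comap (mulTransposeEquiv hF : Matrix G G ℂ →ₗ[ℂ] Matrix G G ℂ) := by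
  have key (A : Matrix G G ℂ) (i j : G) : ∑ k, F i k * conj (F j k) * (A i k - A j k) =
      (A * Fᵀ) i (i - j) - (A * Fᵀ) j (i - j) := by
    simp only [Matrix.mul_apply, Matrix.transpose_apply, ← Finset.sum_sub_distrib, hmul]
    exact Finset.sum_congr rfl fun k _ => by ring
  ext A
  rw [mem_complexDeformations]
  simp only [key, sub_eq_zero]
  constructor
  · intro h i m
    -- With `j = i - m` the column index `i - j` is `m`.
    simpa [mulTransposeEquiv_apply] using h i (i - m)
  · intro h i j
    simpa [mulTransposeEquiv_apply] using h i (i - j)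

theorem undephasedDefect_eq_sum {F : Matrix G G ℂ} (hT : F ∈ torusMatrices G)
    (hU : F ∈ scaledUnitary G) (hmul : ∀ i j k, F i k * conj (F j k) = F (i - j) k) :
    undephasedDefect F = ∑ m : G, Fintype.card G / addOrderOf m := by
  rw [undephasedDefect_eq_finrank hT hU, complexDeformations_eq_comap hU hmul,
    ← finrank_periodicMatrices, ← LinearEquiv.finrank_map_eq (mulTransposeEquiv hU),
    Submodule.map_comap_eq_of_surjective (mulTransposeEquiv hU).surjective]

end CharacterMatrices

/-! ### Fourier matrices are Hadamard with multiplicative rows -/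

section FourierMatrices

open Matrix ComplexConjugate

theorem cyclicFourierMatrix_apply {N : ℕ} [NeZero N] (i j : ZMod N) :
    cyclicFourierMatrix N i j = ZMod.stdAddChar (i * j) := by
  have h : i * j = ((i.val * j.val : ℤ) : ZMod N) := by simp
  rw [h, ZMod.stdAddChar_coe, cyclicFourierMatrix, Matrix.of_apply, ← Complex.exp_nat_mul]
  congr 1
  push_cast
  ring

/-- A factor `ZMod 0 = ℤ` would be an infinite quotient of the finite group `G`. -/
theorem neZero_of_addEquiv_pi_zmod {G : Type*} [AddCommGroup G] [Finite G] {κ : Type*}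
    {N : κ → ℕ} (e : G ≃+ ((i : κ) → ZMod (N i))) (i : κ) : NeZero (N i) := by
  refine ⟨fun h0 => ?_⟩
  have hfin : Finite (ZMod (N i)) := Finite.of_surjective (fun g => e g i)
    ((Function.surjective_eval i).comp e.surjective)
  rw [h0] at hfin
  exact (inferInstance : Infinite ℤ).not_finite hfin

variable {G : Type*} [AddCommGroup G] {s : ℕ} {N : Fin s → ℕ}

theorem fourierMatrix_apply [∀ i, NeZero (N i)] (e : G ≃+ ((i : Fin s) → ZMod (N i))) (g h : G) :
    fourierMatrix e g h = ∏ i, ZMod.stdAddChar (e g i * e h i) := by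
  simp only [fourierMatrix, Matrix.of_apply, cyclicFourierMatrix_apply]

/-- A row of the Fourier matrix is an additive character. -/
def fourierRow [∀ i, NeZero (N i)] (e : G ≃+ ((i : Fin s) → ZMod (N i))) (g : G) :
    AddChar G ℂ where
  toFun h := fourierMatrix e g h
  map_zero_eq_one' := by simp [fourierMatrix_apply]
  map_add_eq_mul' h k := by
    simp [fourierMatrix_apply, mul_add, AddChar.map_add_eq_mul, Finset.prod_mul_distrib]

theorem fourierRow_apply [∀ i, NeZero (N i)] (e : G ≃+ ((i : Fin s) → ZMod (N i))) (g h : G) :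
    fourierRow e g h = fourierMatrix e g h :=
  rfl

/-- Testing on the generator of each cyclic factor recovers the coordinates of `g`. This
nondegeneracy yields the orthogonality of distinct rows. -/
theorem fourierRow_eq_zero_iff [∀ i, NeZero (N i)] (e : G ≃+ ((i : Fin s) → ZMod (N i))) (g : G) :
    fourierRow e g = 0 ↔ g = 0 := by
  constructor
  · intro h
    apply e.injective
    funext i
    have hi := DFunLike.congr_fun h (e.symm (Pi.single i 1))
    rw [fourierRow_apply, fourierMatrix_apply, Finset.prod_eq_single i] at hi
    · rw [AddEquiv.apply_symm_apply, Pi.single_eq_same, mul_one, AddChar.zero_apply,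
        ← AddChar.map_zero_eq_one (ZMod.stdAddChar (N := N i))] at hi
      simpa using ZMod.injective_stdAddChar hi
    · intro j _ hj
      simp [hj]
    · simp
  · rintro rfl
    ext h
    simp [fourierRow_apply, fourierMatrix_apply]

variable [Fintype G]

theorem fourierMatrix_mul_conj (e : G ≃+ ((i : Fin s) → ZMod (N i))) (i j k : G) :
    fourierMatrix e i k * conj (fourierMatrix e j k) = fourierMatrix e (i - j) k := by
  have := neZero_of_addEquiv_pi_zmod e
  simp only [fourierMatrix_apply, map_prod, ← Finset.prod_mul_distrib, ← AddChar.map_neg_eq_conj,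
    ← AddChar.map_add_eq_mul]
  refine Finset.prod_congr rfl fun l _ => congrArg _ ?_
  rw [map_sub, Pi.sub_apply]
  ring

theorem fourierMatrix_mem_torusMatrices (e : G ≃+ ((i : Fin s) → ZMod (N i))) :
    fourierMatrix e ∈ torusMatrices G := by
  have := neZero_of_addEquiv_pi_zmod e
  intro i j
  rw [← fourierRow_apply, AddChar.norm_apply]

variable [DecidableEq G]

theorem fourierMatrix_mul_conjTranspose (e : G ≃+ ((i : Fin s) → ZMod (N i))) :
    fourierMatrix e * (fourierMatrix e)ᴴ = (Fintype.card G : ℂ) • 1 := by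
  classical
  have := neZero_of_addEquiv_pi_zmod e
  ext i j
  simp only [Matrix.mul_apply, Matrix.conjTranspose_apply, RCLike.star_def, fourierMatrix_mul_conj]
  simp only [← fourierRow_apply, AddChar.sum_eq_ite, fourierRow_eq_zero_iff, sub_eq_zero,
    Matrix.smul_apply, Matrix.one_apply, smul_eq_mul, mul_ite, mul_one, mul_zero]

theorem fourierMatrix_mem_scaledUnitary (e : G ≃+ ((i : Fin s) → ZMod (N i))) :
    fourierMatrix e ∈ scaledUnitary G := by
  have hN : (0 : ℝ) < Fintype.card G := Nat.cast_pos.2 Fintype.card_pos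
  have hsq : ((Real.sqrt (Fintype.card G) : ℝ) : ℂ) ≠ 0 :=
    Complex.ofReal_ne_zero.2 (Real.sqrt_pos.2 hN).ne'
  have hmul : ((Real.sqrt (Fintype.card G) : ℝ) : ℂ) * (Real.sqrt (Fintype.card G) : ℝ) =
      Fintype.card G := by
    rw [← Complex.ofReal_mul, Real.mul_self_sqrt hN.le, Complex.ofReal_natCast]
  refine ⟨((Real.sqrt (Fintype.card G) : ℝ) : ℂ)⁻¹ • fourierMatrix e, ?_, ?_⟩
  · rw [Matrix.mem_unitaryGroup_iff, Matrix.star_eq_conjTranspose, Matrix.conjTranspose_smul,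
      Matrix.smul_mul, Matrix.mul_smul, smul_smul, fourierMatrix_mul_conjTranspose, smul_smul,
      ← hmul, star_inv₀, RCLike.star_def, Complex.conj_ofReal]
    rw [show ∀ z : ℂ, z ≠ 0 → z⁻¹ * z⁻¹ * (z * z) = 1 from fun z hz => by field_simp, one_smul]
    exact hsq
  · rw [smul_smul, mul_inv_cancel₀ hsq, one_smul]

theorem undephasedDefect_fourierMatrix (e : G ≃+ ((i : Fin s) → ZMod (N i))) :
    (undephasedDefect (fourierMatrix e) : ℚ) =
      Fintype.card G * ∑ g : G, ((addOrderOf g : ℕ) : ℚ)⁻¹ := by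
  rw [undephasedDefect_eq_sum (fourierMatrix_mem_torusMatrices e)
    (fourierMatrix_mem_scaledUnitary e) (fourierMatrix_mul_conj e), Nat.cast_sum, Finset.mul_sum]
  refine Finset.sum_congr rfl fun g _ => ?_
  rw [Nat.cast_div addOrderOf_dvd_card (Nat.cast_ne_zero.2 (addOrderOf_pos g).ne'), div_eq_mul_inv]

end FourierMatrices

/-! ### Sums of inverse orders in finite abelian groups -/

section OrderSums

theorem sum_inv_addOrderOf_congr {A B : Type*} [AddMonoid A] [AddMonoid B] [Fintype A]
    [Fintype B] (e : A ≃+ B) :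
    ∑ x : A, (addOrderOf x : ℚ)⁻¹ = ∑ y : B, (addOrderOf y : ℚ)⁻¹ :=
  Fintype.sum_equiv e.toEquiv _ _ fun x => by
    rw [AddEquiv.toEquiv_eq_coe, AddEquiv.coe_toEquiv, AddEquiv.addOrderOf_eq]

/-- The order of a tuple is the lcm of the orders of its coordinates, here their product by
coprimality. -/
theorem sum_inv_addOrderOf_pi {κ : Type*} [Fintype κ] [DecidableEq κ] {M : κ → Type*}
    [∀ i, AddGroup (M i)] [∀ i, Fintype (M i)]
    (h : Pairwise fun i j => (Fintype.card (M i)).Coprime (Fintype.card (M j))) :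
    ∑ x : (i : κ) → M i, (addOrderOf x : ℚ)⁻¹ = ∏ i, ∑ x : M i, (addOrderOf x : ℚ)⁻¹ := by
  rw [Fintype.prod_sum]
  refine Finset.sum_congr rfl fun x _ => ?_
  rw [Pi.addOrderOf, Finset.lcm_eq_prod, Nat.cast_prod, Finset.prod_inv_distrib]
  intro i _ j _ hij
  exact Nat.Coprime.of_dvd addOrderOf_dvd_card addOrderOf_dvd_card (h hij)

/-- The number of elements killed by `n`. -/
def torsionCard (A : Type*) [AddCommGroup A] (n : ℕ) : ℕ :=
  Nat.card {x : A // n • x = 0}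

theorem torsionCard_pi {κ : Type*} [Fintype κ] (M : κ → Type*) [∀ i, AddCommGroup (M i)]
    (n : ℕ) : torsionCard ((i : κ) → M i) n = ∏ i, torsionCard (M i) n := by
  simp only [torsionCard]
  rw [← Nat.card_pi]
  refine Nat.card_congr ((Equiv.subtypeEquivRight fun x => ?_).trans Equiv.subtypePiEquivPi)
  exact funext_iff

theorem torsionCard_zmod_prime_pow {p : ℕ} (hp : p.Prime) (b j : ℕ) :
    torsionCard (ZMod (p ^ b)) (p ^ j) = p ^ min b j := by
  have : NeZero (p ^ b) := ⟨pow_ne_zero _ hp.ne_zero⟩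
  have h := IsAddCyclic.card_nsmulAddMonoidHom_ker (G := ZMod (p ^ b)) (p ^ j)
  rw [Nat.card_zmod] at h
  refine h.trans ?_
  rcases le_total b j with hbj | hjb
  · rw [min_eq_left hbj, Nat.gcd_eq_left (pow_dvd_pow p hbj)]
  · rw [min_eq_right hjb, Nat.gcd_eq_right (pow_dvd_pow p hjb)]

/-- The elements killed by `p ^ (j + 1)` but not by `p ^ j` are those of order exactly `p ^ (j +
1)`. -/
theorem sum_inv_addOrderOf_torsion {A : Type*} [AddCommGroup A] [Fintype A] [DecidableEq A]
    {p : ℕ} (hp : p.Prime) (b : ℕ) :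
    ∑ x : A with p ^ b • x = 0, (addOrderOf x : ℚ)⁻¹ =
      1 + ∑ j ∈ Finset.range b,
        ((torsionCard A (p ^ (j + 1)) : ℚ) - torsionCard A (p ^ j)) * ((p : ℚ) ^ (j + 1))⁻¹ := by
  have hcard (n : ℕ) : torsionCard A n = (Finset.univ.filter fun x : A => n • x = 0).card := by
    rw [torsionCard, Nat.card_eq_fintype_card, Fintype.card_subtype]
  induction b with
  | zero => simp [Finset.filter_eq']
  | succ b ih =>
    have hsub : (Finset.univ.filter fun x : A => p ^ b • x = 0) ⊆
        Finset.univ.filter fun x : A => p ^ (b + 1) • x = 0 := by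
      intro x hx
      simp only [Finset.mem_filter, Finset.mem_univ, true_and] at hx ⊢
      rw [pow_succ', mul_smul, hx, smul_zero]
    rw [Finset.sum_range_succ, ← add_assoc, ← ih, ← Finset.sum_sdiff hsub, add_comm, hcard, hcard,
      ← Nat.cast_sub (Finset.card_le_card hsub), ← Finset.card_sdiff_of_subset hsub,
      ← nsmul_eq_mul, ← Finset.sum_const]
    congr 1
    refine Finset.sum_congr rfl fun x hx => ?_
    simp only [Finset.mem_sdiff, Finset.mem_filter, Finset.mem_univ, true_and] at hx
    have : Fact p.Prime := ⟨hp⟩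
    rw [addOrderOf_eq_prime_pow hx.2 hx.1, Nat.cast_pow]

theorem sum_range_eq_sum_blocks (f : ℕ → ℚ) {a : ℕ → ℕ} (h0 : a 0 = 0) {r : ℕ}
    (hmono : ∀ k < r, a k ≤ a (k + 1)) :
    ∑ j ∈ Finset.range (a r), f j =
      ∑ k ∈ Finset.range r, ∑ i ∈ Finset.range (a (k + 1) - a k), f (a k + i) := by
  induction r with
  | zero => simp [h0]
  | succ r ih =>
    rw [Finset.sum_range_succ, ← ih fun k hk => hmono k (by omega), ← Finset.sum_range_add]
    rw [Nat.add_sub_cancel' (hmono r (by omega))]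

theorem le_of_step_le {a : ℕ → ℕ} {r : ℕ} (hmono : ∀ k < r, a k ≤ a (k + 1)) {k l : ℕ}
    (hkl : k ≤ l) (hl : l ≤ r) : a k ≤ a l := by
  induction l, hkl using Nat.le_induction with
  | base => exact le_rfl
  | succ l _ ih => exact (ih (by omega)).trans (hmono l (by omega))

/-- Both endpoints of the block are allowed because the formula is used at `j` and at `j + 1`. -/
theorem sum_min_eq {a : ℕ → ℕ} {r : ℕ} (hmono : ∀ k < r, a k ≤ a (k + 1)) {k j : ℕ} (hk : k < r)
    (h1 : a k ≤ j) (h2 : j ≤ a (k + 1)) :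
    ∑ l ∈ Finset.range r, min (a (l + 1)) j = ∑ l ∈ Finset.range k, a (l + 1) + (r - k) * j := by
  rw [← Finset.sum_range_add_sum_Ico _ hk.le]
  congr 1
  · refine Finset.sum_congr rfl fun l hl => ?_
    have hl := Finset.mem_range.1 hl
    exact min_eq_left ((le_of_step_le hmono (by omega : l + 1 ≤ k) hk.le).trans h1)
  · rw [← Nat.card_Ico, ← smul_eq_mul, ← Finset.sum_const]
    refine Finset.sum_congr rfl fun l hl => ?_
    have hl := Finset.mem_Ico.1 hl
    exact min_eq_right
      (h2.trans (le_of_step_le hmono (by omega : k + 1 ≤ l + 1) (by omega)))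

theorem primeFactorTerm_eq (p r : ℕ) (a : ℕ → ℕ) :
    primeFactorTerm p r a = 1 + ∑ k ∈ Finset.range r,
      (p : ℚ) ^ ((((r - (k + 1)) * a k + ∑ l ∈ Finset.range k, a (l + 1) : ℕ) : ℤ) - 1) *
        ((p : ℚ) ^ (r - k) - 1) * qNumber (a (k + 1) - a k) ((p : ℚ) ^ (r - (k + 1))) := by
  have hshift {M : Type} [AddCommMonoid M] (f : ℕ → M) (n : ℕ) :
      ∑ k ∈ Finset.Icc 1 n, f k = ∑ k ∈ Finset.range n, f (k + 1) := by
    rw [Finset.range_eq_Ico, Finset.sum_Ico_add' f 0 n 1]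
    rfl
  rw [primeFactorTerm, hshift]
  congr 1
  refine Finset.sum_congr rfl fun k hk => ?_
  have hk := Finset.mem_range.1 hk
  rw [Nat.add_sub_cancel, hshift, show r - (k + 1) + 1 = r - k by omega]

theorem sum_inv_addOrderOf_pi_zmod_prime_pow {p : ℕ} (hp : p.Prime) {r : ℕ} {a : ℕ → ℕ}
    [∀ k : Fin r, NeZero (p ^ a (k + 1))]
    (h0 : a 0 = 0) (hmono : ∀ k < r, a k ≤ a (k + 1)) :
    ∑ x : (k : Fin r) → ZMod (p ^ a (k + 1)), (addOrderOf x : ℚ)⁻¹ = primeFactorTerm p r a := by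
  have hp0 : (p : ℚ) ≠ 0 := Nat.cast_ne_zero.2 hp.ne_zero
  have hcard (j : ℕ) : (torsionCard ((k : Fin r) → ZMod (p ^ a (k + 1))) (p ^ j) : ℚ) =
      (p : ℚ) ^ (∑ l ∈ Finset.range r, min (a (l + 1)) j) := by
    rw [torsionCard_pi, Finset.sum_range, ← Finset.prod_pow_eq_pow_sum, Nat.cast_prod]
    refine Finset.prod_congr rfl fun k _ => ?_
    rw [torsionCard_zmod_prime_pow hp, Nat.cast_pow]
  have hall (x : (k : Fin r) → ZMod (p ^ a (k + 1))) : p ^ a r • x = 0 := by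
    funext k
    obtain ⟨c, hc⟩ := pow_dvd_pow p (le_of_step_le hmono (by omega : (k : ℕ) + 1 ≤ r) le_rfl)
    rw [Pi.smul_apply, hc, nsmul_eq_mul, Nat.cast_mul, ZMod.natCast_self, zero_mul, zero_mul]
    rfl
  have h := sum_inv_addOrderOf_torsion (A := (k : Fin r) → ZMod (p ^ a (k + 1))) hp (a r)
  rw [Finset.filter_true_of_mem fun x _ => hall x] at h
  rw [h, sum_range_eq_sum_blocks _ h0 hmono, primeFactorTerm_eq]
  congr 1
  refine Finset.sum_congr rfl fun k hk => ?_
  have hk := Finset.mem_range.1 hk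
  rw [qNumber, Finset.mul_sum]
  refine Finset.sum_congr rfl fun i hi => ?_
  have hi := Finset.mem_range.1 hi
  rw [hcard, hcard, sum_min_eq hmono hk (by omega) (by omega),
    sum_min_eq hmono hk (by omega) (by omega)]
  -- Writing `j = a k + i`, the term is `p ^ (c + (q + 1) * j) * (p ^ (q + 1) - 1) / p ^ (j + 1)`,
  -- that is, `p ^ (c + q * a k - 1) * (p ^ (q + 1) - 1) * (p ^ q) ^ i`.
  obtain ⟨q, hq⟩ : ∃ q, r = k + 1 + q := ⟨r - (k + 1), by omega⟩
  rw [show r - k = q + 1 by omega, show r - (k + 1) = q by omega, zpow_sub_one₀ hp0, zpow_natCast]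
  generalize ∑ l ∈ Finset.range k, a (l + 1) = c
  field_simp
  ring

end OrderSums

end FourierDefect

end

theorem theorem5p6 {G : Type*} [AddCommGroup G] [Fintype G] [DecidableEq G]
    -- a decomposition into cyclic groups, which gives the Fourier matrix
    {s : ℕ} {N : Fin s → ℕ} (e : G ≃+ ((i : Fin s) → ZMod (N i)))
    -- the decomposition into `p`-components, `G_p = ℤ_{p ^ a_1} × ⋯ × ℤ_{p ^ a_r}`
    (S : Finset ℕ) (hS : ∀ p ∈ S, p.Prime)
    (r : ℕ → ℕ) (a : ℕ → ℕ → ℕ)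
    (ha_zero : ∀ p ∈ S, a p 0 = 0)
    (ha_mono : ∀ p ∈ S, ∀ k, 1 ≤ k → k < r p → a p k ≤ a p (k + 1))
    (decomp : G ≃+ ((p : S) → (k : Fin (r p)) → ZMod ((p : ℕ) ^ a p (k + 1)))) :
    (FourierDefect.undephasedDefect (FourierDefect.fourierMatrix e) : ℚ) =
      Fintype.card G * ∏ p ∈ S, FourierDefect.primeFactorTerm p (r p) (a p) := by
  have hne (p : S) (k : Fin (r p)) : NeZero ((p : ℕ) ^ a p (k + 1)) :=
    ⟨pow_ne_zero _ (hS p p.2).ne_zero⟩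
  rw [FourierDefect.undephasedDefect_fourierMatrix, FourierDefect.sum_inv_addOrderOf_congr decomp,
    FourierDefect.sum_inv_addOrderOf_pi, ← Finset.prod_coe_sort S]
  · congr 1
    refine Finset.prod_congr rfl fun p _ => ?_
    refine FourierDefect.sum_inv_addOrderOf_pi_zmod_prime_pow (hS p p.2) (ha_zero p p.2) ?_
    intro k hk
    -- Monotonicity is assumed only from `k = 1`; the step from `0` uses `a p 0 = 0`.
    rcases Nat.eq_zero_or_pos k with rfl | hk0
    · rw [ha_zero p p.2]
      exact Nat.zero_le _
    · exact ha_mono p p.2 k hk0 hk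
  · intro p q hpq
    have hcop : Nat.Coprime (p : ℕ) q :=
      (Nat.coprime_primes (hS p p.2) (hS q q.2)).2 fun h => hpq (Subtype.ext h)
    simp only [Fintype.card_pi, ZMod.card]
    exact Nat.Coprime.prod_left fun k _ => Nat.Coprime.prod_right fun l _ => hcop.pow _ _
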